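/- Say that a metric space $(M,d_M)$ embeds with bi-Lipschitz distortion $D\ge 1$ into a normed space $(Z,\|\cdot\|_Z)$ if there is a map $f:M\to Z$ such that $d_M(x,y)\le \|f(x)-f(y)\|_Z\le D\, d_M(x,y)$ for all $x,y\in M$. For $\omega\in(0,1]$, the $\omega$-snowflake of $(M,d_M)$ is the metric space $(M,d_M^\omega)$. There is a universal constant $c>0$ such that for every $\omega\in(0,1]$ and every integer $k\ge 1$ the following two assertions hold. 1. For every $k$-dimensional real normed space $X$ there is a Hilbert space $H$ such that the $\omega$-snowflake of $X$ embeds into $H$ with bi-Lipschitz distortion $k^{\omega/2}$. 2. Conversely, if $H$ is a Hilbert space and $D\ge 1$ is such that the $\omega$-snowflake of $\ell_\infty^k$ (that is, $\mathbb{R}^k$ with the supremum norm) embeds into $H$ with bi-Lipschitz distortion $D$, then $D\ge c\,k^{\omega/2}$. -/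

import Mathlib

/-- The metric space `M` embeds into the metric space `Z` with bi-Lipschitz distortion `D ≥ 1`:
there is a `D`-Lipschitz map `f : M → Z` that does not decrease distances. -/
def EmbedsWithBiLipschitzDistortion (M Z : Type*) [MetricSpace M] [MetricSpace Z] (D : ℝ) : Prop :=
  1 ≤ D ∧ ∃ f : M → Z,
    (∀ x y : M, dist (f x) (f y) ≤ D * dist x y) ∧ ∀ x y : M, dist x y ≤ dist (f x) (f y)

/-!
The upper bound is John's theorem followed by Schoenberg's. By `exists_euclidean_norm_equiv`, a
`k`-dimensional normed space carries a Euclidean norm with `‖x‖ ≤ |x| ≤ √k * ‖x‖`; it comes from a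
linear image of the Euclidean ball of maximal volume inside the unit ball, since a point of the unit
ball at Euclidean distance more than `√k` from the origin would leave room for an ellipsoid of
larger volume. By `exists_snowflake_isometry_hilbert`, the `ω`-snowflake of the Euclidean norm
embeds isometrically into a Hilbert space: `|x| ^ (2 * ω)` is a mixture of the functions
`2 - 2 * exp (-(t * |x|) ^ 2 / 2)`, and these are squared distances between Gaussian characters.
Raising John's inequalities to the power `ω` gives the distortion `k ^ (ω / 2)`.

The lower bound rests on a metric form of the cotype `2` of Hilbert space,
`sum_norm_iterate_sub_sq_le`, whose source is the parallelogram law. Applied to functions `F` from a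
finite abelian group to a Hilbert space (`sum_sum_norm_translate_sub_sq_le`), it says that the
mean squares of the displacements of `F` by `n` steps in each of `k` directions add up to at most
`4 * n ^ 2 + 8 * k` times the square of the largest displacement by one simultaneous step in several
directions. On a discrete torus of side of order `√k`, mapped to `ℓ_∞^k` by cosines, simultaneous
steps have length of order `1 / √k` and half turns have length of order `1`. For an embedding of the
`ω`-snowflake with distortion `D` this reads `k ≲ k * (D * k ^ (-ω / 2)) ^ 2`, which is the claim.
-/

/-! ### Metric cotype of Hilbert space -/

open Finset in
/-- A cotype-type inequality for linear isometries `U i` of an inner product space. `K i` stands for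
the orbit of `f` under the products of distinct `U j`, `j < i`; if the last orbit has diameter at
most `r`, then moving `f` by the `n`-th powers of the `U i` costs, in quadratic mean over the `k`
directions, `O(r ^ 2)` as soon as `n ^ 2` is of order `k`.

Let `g 0 = f` and `g (i + 1) = (g i + U i (g i)) / 2`. By the parallelogram law the quantities
`‖U i (g i) - g i‖ ^ 2` add up to `4 * (‖f‖ ^ 2 - ‖g k‖ ^ 2)`, which is at most `2 * r ^ 2`, so they
bound the displacements of `g i` by `(U i)^[n]`; replacing `g i` by `f` costs at most `2 * r`
in each direction. -/
theorem sum_norm_iterate_sub_sq_le {L : Type*} [NormedAddCommGroup L] [InnerProductSpace ℝ L]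
    (U : ℕ → L →ₗᵢ[ℝ] L) (K : ℕ → Set L) (hK : Monotone K)
    (hU : ∀ i, ∀ p ∈ K i, U i p ∈ K (i + 1)) {f : L} (hf : f ∈ K 0) (k : ℕ) {r : ℝ}
    (hnorm : ∀ p ∈ K k, ‖p‖ = ‖f‖) (hr : ∀ p ∈ K k, ∀ q ∈ K k, ‖p - q‖ ≤ r) (n : ℕ) :
    ∑ i ∈ range k, ‖(U i)^[n] f - f‖ ^ 2 ≤ (4 * n ^ 2 + 8 * k) * r ^ 2 := by
  have hfk : f ∈ K k := hK (Nat.zero_le k) hf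
  have hr0 : 0 ≤ r := (norm_nonneg _).trans (hr f hfk f hfk)
  -- `g i` is the average of the orbit of `f` under the products of distinct `U j`, `j < i`.
  let g : ℕ → L := fun i ↦ Nat.rec f (fun i g ↦ (1 / 2 : ℝ) • g + (1 / 2 : ℝ) • U i g) i
  have g0 : g 0 = f := rfl
  have gs : ∀ i, g (i + 1) = (1 / 2 : ℝ) • g i + (1 / 2 : ℝ) • U i (g i) := fun i ↦ rfl
  have hg : ∀ i, g i ∈ convexHull ℝ (K i) := by
    intro i
    induction i with
    | zero => exact subset_convexHull ℝ _ hf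
    | succ i ih =>
      have h1 : U i (g i) ∈ convexHull ℝ (K (i + 1)) := by
        have h2 : U i (g i) ∈ (U i).toLinearMap '' convexHull ℝ (K i) := ⟨g i, ih, rfl⟩
        rw [LinearMap.image_convexHull] at h2
        refine convexHull_mono ?_ h2
        rintro _ ⟨p, hp, rfl⟩
        exact hU i p hp
      rw [gs]
      exact convex_convexHull ℝ _ (convexHull_mono (hK i.le_succ) ih) h1
        (by norm_num) (by norm_num) (by norm_num)
  -- the squared norm lost by each averaging step is given by the parallelogram law
  have hstep : ∀ i, ‖U i (g i) - g i‖ ^ 2 = 4 * (‖g i‖ ^ 2 - ‖g (i + 1)‖ ^ 2) := by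
    intro i
    have h := parallelogram_law_with_norm ℝ (U i (g i)) (g i)
    have h2 : ‖g (i + 1)‖ = 1 / 2 * ‖U i (g i) + g i‖ := by
      rw [gs, ← smul_add, norm_smul, add_comm]; norm_num
    rw [h2]
    rw [(U i).norm_map] at h
    nlinarith
  have htele : ∑ i ∈ range k, ‖U i (g i) - g i‖ ^ 2 = 4 * (‖f‖ ^ 2 - ‖g k‖ ^ 2) := by
    simp_rw [hstep, ← mul_sum]
    rw [sum_range_sub', g0]
  have hdist : ∀ i ≤ k, ‖g i - f‖ ≤ r := by
    intro i hi
    have h1 : convexHull ℝ (K i) ⊆ Metric.closedBall f r := by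
      refine convexHull_min (fun p hp ↦ ?_) (convex_closedBall f r)
      rw [mem_closedBall_iff_norm]
      exact hr p (hK hi hp) f hfk
    exact mem_closedBall_iff_norm.1 (h1 (hg i))
  -- `K k` lies on a sphere and has small diameter, so its convex hull stays close to the sphere
  have hinner : ‖f‖ ^ 2 - r ^ 2 / 2 ≤ ‖g k‖ ^ 2 := by
    have h1 : ∀ p ∈ K k, ∀ q ∈ K k, ‖f‖ ^ 2 - r ^ 2 / 2 ≤ inner ℝ p q := by
      intro p hp q hq
      have h := norm_sub_sq_real p q
      rw [hnorm p hp, hnorm q hq] at h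
      have := pow_le_pow_left₀ (norm_nonneg _) (hr p hp q hq) 2
      linarith
    have hconv : ∀ p : L, Convex ℝ {q : L | ‖f‖ ^ 2 - r ^ 2 / 2 ≤ inner ℝ p q} := fun p ↦
      convex_halfSpace_ge (innerₛₗ ℝ p).isLinear _
    have h2 : ∀ p ∈ K k, ‖f‖ ^ 2 - r ^ 2 / 2 ≤ inner ℝ p (g k) := fun p hp ↦
      convexHull_min (h1 p hp) (hconv p) (hg k)
    have h3 : ‖f‖ ^ 2 - r ^ 2 / 2 ≤ inner ℝ (g k) (g k) :=
      convexHull_min (fun p hp ↦ by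
        simpa only [Set.mem_ofPred_eq, real_inner_comm] using h2 p hp) (hconv (g k)) (hg k)
    rwa [real_inner_self_eq_norm_sq] at h3
  have hiter : ∀ (V : L →ₗᵢ[ℝ] L) (x : L) (n : ℕ), ‖V^[n] x - x‖ ≤ n * ‖V x - x‖ := by
    intro V x n
    induction n with
    | zero => simp
    | succ n ih =>
      have h1 : ‖V^[n + 1] x - V x‖ = ‖V^[n] x - x‖ := by
        rw [Function.iterate_succ_apply', ← map_sub, V.norm_map]
      calc _ = ‖(V^[n + 1] x - V x) + (V x - x)‖ := by congr 1; abel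
        _ ≤ _ := norm_add_le _ _
        _ ≤ _ := by rw [h1]; push_cast; linarith
  have hterm : ∀ i ∈ range k, ‖(U i)^[n] f - f‖ ^ 2
      ≤ 2 * n ^ 2 * ‖U i (g i) - g i‖ ^ 2 + 8 * r ^ 2 := by
    intro i hi
    have h1 : ‖(U i)^[n] f - (U i)^[n] (g i)‖ ≤ r := by
      have h : ∀ n, ‖(U i)^[n] f - (U i)^[n] (g i)‖ = ‖f - g i‖ := fun n ↦ by
        induction n with
        | zero => rfl
        | succ n ih =>
          rw [Function.iterate_succ_apply', Function.iterate_succ_apply', ← map_sub,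
            (U i).norm_map, ih]
      rw [h, norm_sub_rev]
      exact hdist i (mem_range.1 hi).le
    have h2 := hdist i (mem_range.1 hi).le
    have h3 : ‖(U i)^[n] f - f‖ ≤ n * ‖U i (g i) - g i‖ + 2 * r := by
      calc _ = ‖((U i)^[n] f - (U i)^[n] (g i)) + ((U i)^[n] (g i) - g i) + (g i - f)‖ := by
            congr 1; abel
        _ ≤ _ := norm_add₃_le
        _ ≤ _ := by linarith [hiter (U i) (g i) n]
    calc _ ≤ (n * ‖U i (g i) - g i‖ + 2 * r) ^ 2 := pow_le_pow_left₀ (norm_nonneg _) h3 2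
      _ ≤ _ := by nlinarith [sq_nonneg (n * ‖U i (g i) - g i‖ - 2 * r)]
  calc _ ≤ ∑ i ∈ range k, (2 * n ^ 2 * ‖U i (g i) - g i‖ ^ 2 + 8 * r ^ 2) := sum_le_sum hterm
    _ = 2 * n ^ 2 * (4 * (‖f‖ ^ 2 - ‖g k‖ ^ 2)) + k * (8 * r ^ 2) := by
      rw [sum_add_distrib, ← mul_sum, htele]; simp
    _ ≤ 2 * n ^ 2 * (4 * (r ^ 2 / 2)) + k * (8 * r ^ 2) := by gcongr; linarith
    _ = _ := by ring

open Finset in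
/-- The inequality `sum_norm_iterate_sub_sq_le` for translations of Hilbert-space-valued functions
on a finite abelian group: if `F` moves by at most `r` between any two translates of a point by
sums of distinct `e i`, then its displacements by `n • e i` are controlled in quadratic mean. -/
theorem sum_sum_norm_translate_sub_sq_le {G H : Type*} [AddCommGroup G] [Fintype G]
    [NormedAddCommGroup H] [InnerProductSpace ℝ H] (F : G → H) (e : ℕ → G) (k : ℕ) {r : ℝ}
    (hr : ∀ s t : Finset ℕ, ∀ x, ‖F (x + ∑ i ∈ s, e i) - F (x + ∑ i ∈ t, e i)‖ ≤ r) (n : ℕ) :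
    ∑ i ∈ range k, ∑ x, ‖F (x + n • e i) - F x‖ ^ 2
      ≤ (4 * n ^ 2 + 8 * k) * (Fintype.card G * r ^ 2) := by
  have hr0 : 0 ≤ r := (norm_nonneg _).trans (hr ∅ ∅ 0)
  -- translation by `a`, acting on the space `ℓ²(G; H)`
  let τ : G → PiLp 2 (fun _ : G ↦ H) →ₗᵢ[ℝ] PiLp 2 (fun _ : G ↦ H) := fun a ↦
    (LinearIsometryEquiv.piLpCongrLeft 2 ℝ H (Equiv.subRight a)).toLinearIsometry
  have hτ : ∀ a p x, τ a p x = p (x + a) := fun a p x ↦ rfl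
  have hτi : ∀ a (n : ℕ) p x, (τ a)^[n] p x = p (x + n • a) := by
    intro a n
    induction n with
    | zero => simp
    | succ n ih =>
      intro p x
      rw [Function.iterate_succ_apply', hτ, ih, succ_nsmul', add_assoc]
  let f : PiLp 2 (fun _ : G ↦ H) := WithLp.toLp 2 F
  have hfx : ∀ x, f x = F x := fun x ↦ rfl
  let K : ℕ → Set (PiLp 2 (fun _ : G ↦ H)) := fun i ↦
    {p | ∃ s ⊆ range i, p = τ (∑ i ∈ s, e i) f}
  have key := sum_norm_iterate_sub_sq_le (fun i ↦ τ (e i)) K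
    (fun i j hij p ⟨s, hs, hp⟩ ↦ ⟨s, hs.trans (range_mono hij), hp⟩)
    (fun i p ⟨s, hs, hp⟩ ↦ by
      have hi : i ∉ s := fun h ↦ by simpa using hs h
      refine ⟨insert i s, ?_, ?_⟩
      · rw [range_add_one]
        exact insert_subset_insert _ hs
      · ext x
        rw [hp, hτ, hτ, hτ, sum_insert hi, add_assoc])
    (f := f) ⟨∅, by simp, by ext x; simp [hτ]⟩ k (r := √(Fintype.card G) * r)
    (fun p ⟨s, hs, hp⟩ ↦ by rw [hp, (τ _).norm_map])
    (fun p ⟨s, hs, hp⟩ q ⟨t, ht, hq⟩ ↦ by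
      refine le_of_sq_le_sq ?_ (by positivity)
      rw [PiLp.norm_sq_eq_of_L2, mul_pow, Real.sq_sqrt (by positivity)]
      calc _ ≤ ∑ x : G, r ^ 2 := by
            refine sum_le_sum fun x _ ↦ pow_le_pow_left₀ (norm_nonneg _) ?_ 2
            rw [PiLp.sub_apply, hp, hq]
            exact hr s t x
        _ = _ := by simp)
    n
  rw [mul_pow, Real.sq_sqrt (by positivity)] at key
  refine le_trans (le_of_eq ?_) key
  refine sum_congr rfl fun i _ ↦ ?_
  rw [PiLp.norm_sq_eq_of_L2]
  simp only [PiLp.sub_apply, hτi, hfx]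

/-! ### The lower bound on a discrete torus -/

theorem ZMod.norm_stdAddChar_one_sub_one_le (m : ℕ) [NeZero m] :
    ‖ZMod.stdAddChar (1 : ZMod m) - 1‖ ≤ 2 * Real.pi / m := by
  have h : ZMod.stdAddChar (1 : ZMod m)
      = Complex.exp (Complex.I * ((2 * Real.pi / m : ℝ) : ℂ)) := by
    have := ZMod.stdAddChar_coe (N := m) 1
    rw [Int.cast_one] at this
    rw [this]
    congr 1
    push_cast
    ring
  rw [h]
  refine Real.norm_exp_I_mul_ofReal_sub_one_le.trans_eq ?_
  exact Real.norm_of_nonneg (by positivity)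

theorem ZMod.stdAddChar_quarter (q : ℕ) [NeZero (4 * q)] :
    ZMod.stdAddChar (q : ZMod (4 * q)) = Complex.I := by
  have hq : (q : ℂ) ≠ 0 := by
    have := NeZero.ne (4 * q)
    exact_mod_cast fun h : q = 0 ↦ this (by simp [h])
  have := ZMod.stdAddChar_coe (N := 4 * q) q
  rw [Int.cast_natCast] at this
  refine (this.trans (congrArg Complex.exp ?_)).trans Complex.exp_pi_div_two_mul_I
  push_cast
  field_simp
  ring

open Finset in
/-- The lower bound for the distortion of the `ω`-snowflake of `ℓ_∞^k` in an inner product space.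
The discrete torus `(ℤ / 4q)^k` with `q` of order `√k` is mapped to `ℓ_∞^k` by the cosine of each
coordinate. A step in `{-1, 0, 1}^k` then has length `O(1 / √k)`, so its image in `H` has length
`O(D * k ^ (-ω / 2))`, while half a turn in one coordinate has length of order `1` on average; the
inequality `sum_sum_norm_translate_sub_sq_le` compares the two. -/
theorem rpow_le_distortion_of_embeds_snowflake {ω : ℝ} (hω₀ : 0 < ω) (hω₁ : ω ≤ 1) {k : ℕ}
    (hk : 1 ≤ k) {H : Type*} [NormedAddCommGroup H] [InnerProductSpace ℝ H] {D : ℝ}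
    (h : EmbedsWithBiLipschitzDistortion (Metric.Snowflaking (Fin k → ℝ) ω hω₀ hω₁) H D) :
    1 / 24 * (k : ℝ) ^ (ω / 2) ≤ D := by
  obtain ⟨hD, f₀, hup, hlow⟩ := h
  obtain ⟨f, hf⟩ : ∃ f : (Fin k → ℝ) → H, ∀ x y,
      dist x y ^ ω ≤ ‖f x - f y‖ ∧ ‖f x - f y‖ ≤ D * dist x y ^ ω :=
    ⟨fun x ↦ f₀ (Metric.Snowflaking.toSnowflaking x), fun x y ↦ by
      rw [← dist_eq_norm]
      exact ⟨hlow _ _, hup _ _⟩⟩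
  have hk' : (1 : ℝ) ≤ k := by exact_mod_cast hk
  have hk0 : (0 : ℝ) < k := by linarith
  have hsq : (1 : ℝ) ≤ √k := Real.one_le_sqrt.2 hk'
  -- `q` is of order `√k`, which balances the terms `n ^ 2` and `k` of the inequality on the torus
  obtain ⟨q, hq1, hq2⟩ : ∃ q : ℕ, √k ≤ q ∧ (q : ℝ) ≤ 2 * √k :=
    ⟨⌈√k⌉₊, Nat.le_ceil _, by linarith [Nat.ceil_lt_add_one (Real.sqrt_nonneg k)]⟩
  have hq0 : (0 : ℝ) < q := by linarith
  have hq0' : 0 < q := by exact_mod_cast hq0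
  have : NeZero (4 * q) := ⟨by omega⟩
  let χ : AddChar (ZMod (4 * q)) ℂ := ZMod.stdAddChar
  have hχn : ∀ a, ‖χ a‖ = 1 := fun a ↦ AddChar.norm_apply χ a
  let φ : (Fin k → ZMod (4 * q)) → Fin k → ℝ := fun x j ↦ (χ (x j)).re
  let e : ℕ → Fin k → ZMod (4 * q) := fun i j ↦ if (j : ℕ) = i then 1 else 0
  have hes : ∀ (s : Finset ℕ) j, (∑ i ∈ s, e i) j = if (j : ℕ) ∈ s then 1 else 0 := by
    intro s j
    rw [Finset.sum_apply]
    simp [e]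
  have hφ : ∀ (s t : Finset ℕ) x,
      dist (φ (x + ∑ i ∈ s, e i)) (φ (x + ∑ i ∈ t, e i)) ≤ 2 / √k := by
    intro s t x
    have hstep : ‖χ 1 - 1‖ ≤ 2 / √k := by
      refine (ZMod.norm_stdAddChar_one_sub_one_le (4 * q)).trans ?_
      rw [div_le_div_iff₀ (by positivity) (by positivity)]
      push_cast
      nlinarith [Real.pi_lt_four, Real.pi_pos]
    rw [dist_pi_le_iff (by positivity)]
    intro j
    have h1 : ‖χ ((∑ i ∈ s, e i) j) - χ ((∑ i ∈ t, e i) j)‖ ≤ 2 / √k := by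
      rw [hes, hes]
      split_ifs
      · simp; positivity
      · rwa [AddChar.map_zero_eq_one]
      · rwa [AddChar.map_zero_eq_one, norm_sub_rev]
      · simp; positivity
    calc dist (φ (x + ∑ i ∈ s, e i) j) (φ (x + ∑ i ∈ t, e i) j)
        = |(χ (x j) * (χ ((∑ i ∈ s, e i) j) - χ ((∑ i ∈ t, e i) j))).re| := by
          rw [mul_sub, ← AddChar.map_add_eq_mul, ← AddChar.map_add_eq_mul, Complex.sub_re,
            Real.dist_eq]
          rfl
      _ ≤ ‖χ (x j) * (χ ((∑ i ∈ s, e i) j) - χ ((∑ i ∈ t, e i) j))‖ := Complex.abs_re_le_norm _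
      _ ≤ 2 / √k := by rwa [norm_mul, hχn, one_mul]
  have key := sum_sum_norm_translate_sub_sq_le (fun x ↦ f (φ x)) e k
    (r := D * (2 / √k) ^ ω)
    (fun s t x ↦ (hf _ _).2.trans (by
      gcongr
      exact hφ s t x)) (2 * q)
  -- half a period in the direction `i` negates the `i`-th coordinate of `φ`
  have hterm : ∀ i : Fin k, ∀ x, (χ (x i)).re ^ 2
      ≤ ‖f (φ (x + (2 * q) • e i)) - f (φ x)‖ ^ 2 := by
    intro i x
    have h1 : χ ((x + (2 * q) • e i) i) = -χ (x i) := by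
      have : (x + (2 * q) • e i) i = x i + (q + q) := by
        simp [e, two_mul]
      rw [this, AddChar.map_add_eq_mul, AddChar.map_add_eq_mul,
        show χ q = Complex.I from ZMod.stdAddChar_quarter q, Complex.I_mul_I, mul_neg_one]
    set c := |(χ (x i)).re| with hc
    have hc0 : 0 ≤ c := abs_nonneg _
    have hc1 : c ≤ 1 := (Complex.abs_re_le_norm _).trans_eq (hχn _)
    have h2 : c ≤ dist (φ (x + (2 * q) • e i)) (φ x) := by
      refine le_trans ?_ (dist_le_pi_dist _ _ i)
      change c ≤ |(χ ((x + (2 * q) • e i) i)).re - (χ (x i)).re|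
      rw [h1, Complex.neg_re, show -(χ (x i)).re - (χ (x i)).re = -2 * (χ (x i)).re by ring,
        abs_mul, ← hc]
      norm_num
      linarith
    -- since `c ≤ 1`, the snowflaked distance `c ^ ω` is at least `c`
    have h3 : c ≤ ‖f (φ (x + (2 * q) • e i)) - f (φ x)‖ := by
      calc c = c ^ (1 : ℝ) := (Real.rpow_one c).symm
        _ ≤ c ^ ω := Real.rpow_le_rpow_of_exponent_ge' hc0 hc1 hω₀.le hω₁
        _ ≤ _ := Real.rpow_le_rpow hc0 h2 hω₀.le
        _ ≤ _ := (hf _ _).1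
    rw [← sq_abs]
    exact pow_le_pow_left₀ hc0 h3 2
  -- a quarter period turns the real part of `χ` into minus its imaginary part,
  -- so `re ^ 2` has average `1 / 2`
  have havg : ∀ i : Fin k, ∑ x : Fin k → ZMod (4 * q), (χ (x i)).re ^ 2
      = Fintype.card (Fin k → ZMod (4 * q)) / 2 := by
    intro i
    have h1 : ∑ x : Fin k → ZMod (4 * q), (χ (x i)).re ^ 2
        = ∑ x : Fin k → ZMod (4 * q), (χ (x i)).im ^ 2 := by
      rw [← Equiv.sum_comp (Equiv.addRight (fun _ ↦ (q : ZMod (4 * q))))]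
      refine sum_congr rfl fun x _ ↦ ?_
      rw [Equiv.coe_addRight]
      beta_reduce
      rw [Pi.add_apply, AddChar.map_add_eq_mul,
        show χ q = Complex.I from ZMod.stdAddChar_quarter q]
      simp
    have h2 : ∑ x : Fin k → ZMod (4 * q), ((χ (x i)).re ^ 2 + (χ (x i)).im ^ 2)
        = Fintype.card (Fin k → ZMod (4 * q)) := by
      rw [sum_congr rfl fun x _ ↦ show (χ (x i)).re ^ 2 + (χ (x i)).im ^ 2 = 1 by
        have := Complex.sq_norm (χ (x i))
        rw [hχn, Complex.normSq_apply] at this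
        linarith]
      simp
    rw [sum_add_distrib] at h2
    linarith
  set N : ℝ := (Fintype.card (Fin k → ZMod (4 * q)) : ℝ) with hN
  have hN0 : 0 < N := by
    rw [hN]; exact_mod_cast Fintype.card_pos
  have hleft : k * (N / 2)
      ≤ ∑ i ∈ range k, ∑ x, ‖f (φ (x + (2 * q) • e i)) - f (φ x)‖ ^ 2 := by
    calc k * (N / 2) = ∑ i : Fin k, N / 2 := by simp
      _ ≤ ∑ i : Fin k, ∑ x, ‖f (φ (x + (2 * q) • e i)) - f (φ x)‖ ^ 2 := by
          refine sum_le_sum fun i _ ↦ ?_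
          rw [← havg i]
          exact sum_le_sum fun x _ ↦ hterm i x
      _ = _ := Fin.sum_univ_eq_sum_range
          (fun i ↦ ∑ x, ‖f (φ (x + (2 * q) • e i)) - f (φ x)‖ ^ 2) k
  have hkk : √k ^ 2 = (k : ℝ) := Real.sq_sqrt hk0.le
  have hcoef : 4 * ((2 * q : ℕ) : ℝ) ^ 2 + 8 * k ≤ 72 * k := by
    push_cast
    nlinarith [pow_le_pow_left₀ hq0.le hq2 2]
  have hmain : k * (N / 2) ≤ 72 * k * (N * (D * (2 / √k) ^ ω) ^ 2) :=
    (hleft.trans key).trans (by gcongr)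
  have hr : 1 ≤ 144 * (D * (2 / √k) ^ ω) ^ 2 := by
    have : k * N * 1 ≤ k * N * (144 * (D * (2 / √k) ^ ω) ^ 2) := by linarith
    exact le_of_mul_le_mul_left this (by positivity)
  have hr2 : 1 ≤ 12 * (D * (2 / √k) ^ ω) := by
    refine le_of_sq_le_sq ?_ (by positivity)
    linarith [mul_pow 12 (D * (2 / √k) ^ ω) 2]
  have hpow : (2 / √k) ^ ω ≤ 2 / (k : ℝ) ^ (ω / 2) := by
    rw [Real.div_rpow (by norm_num) (Real.sqrt_nonneg _), Real.sqrt_eq_rpow, ← Real.rpow_mul hk0.le,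
      show 1 / 2 * ω = ω / 2 by ring]
    gcongr
    calc (2 : ℝ) ^ ω ≤ 2 ^ (1 : ℝ) := Real.rpow_le_rpow_of_exponent_le (by norm_num) hω₁
      _ = 2 := Real.rpow_one 2
  have hkω : 0 < (k : ℝ) ^ (ω / 2) := by positivity
  have h5 : 1 ≤ 12 * (D * (2 / (k : ℝ) ^ (ω / 2))) := hr2.trans (by gcongr)
  rw [show 12 * (D * (2 / (k : ℝ) ^ (ω / 2))) = 24 * D / (k : ℝ) ^ (ω / 2) by ring,
    le_div_iff₀ hkω] at h5
  linarith

/-! ### Snowflakes of Euclidean spaces -/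

open MeasureTheory ProbabilityTheory Set Real in
theorem integrableOn_one_sub_exp_mul_rpow {ω : ℝ} (hω₀ : 0 < ω) (hω₁ : ω < 1) :
    IntegrableOn (fun t : ℝ ↦ (2 - 2 * exp (-t ^ 2 / 2)) * t ^ (-1 - 2 * ω)) (Ioi 0) := by
  have hmeas : Measurable fun t : ℝ ↦ (2 - 2 * exp (-t ^ 2 / 2)) * t ^ (-1 - 2 * ω) := by
    fun_prop
  have hnonneg : ∀ t : ℝ, 0 < t → 0 ≤ (2 - 2 * exp (-t ^ 2 / 2)) * t ^ (-1 - 2 * ω) := by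
    intro t ht
    have : exp (-t ^ 2 / 2) ≤ 1 := exp_le_one_iff.2 (by nlinarith [sq_nonneg t])
    have := rpow_pos_of_pos ht (-1 - 2 * ω)
    exact mul_nonneg (by linarith) this.le
  rw [← Ioc_union_Ioi_eq_Ioi zero_le_one]
  refine IntegrableOn.union ?_ ?_
  · have h1 : IntegrableOn (fun t : ℝ ↦ t ^ (1 - 2 * ω)) (Ioc 0 1) := by
      rw [← intervalIntegrable_iff_integrableOn_Ioc_of_le zero_le_one]
      exact intervalIntegral.intervalIntegrable_rpow' (by linarith)
    refine h1.mono' hmeas.aestronglyMeasurable ?_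
    refine (ae_restrict_iff' measurableSet_Ioc).2 (.of_forall fun t ht ↦ ?_)
    rw [norm_of_nonneg (hnonneg t ht.1), show 1 - 2 * ω = 2 + (-1 - 2 * ω) by ring,
      rpow_add ht.1, rpow_two]
    have := add_one_le_exp (-t ^ 2 / 2)
    exact mul_le_mul_of_nonneg_right (by linarith) (rpow_pos_of_pos ht.1 _).le
  · have h1 : IntegrableOn (fun t : ℝ ↦ 2 * t ^ (-1 - 2 * ω)) (Ioi 1) :=
      (integrableOn_Ioi_rpow_of_lt (by linarith) zero_lt_one).const_mul 2
    refine h1.mono' hmeas.aestronglyMeasurable ?_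
    refine (ae_restrict_iff' measurableSet_Ioi).2 (.of_forall fun t ht ↦ ?_)
    have ht0 : 0 < t := zero_lt_one.trans ht
    rw [norm_of_nonneg (hnonneg t ht0)]
    have := exp_pos (-t ^ 2 / 2)
    exact mul_le_mul_of_nonneg_right (by linarith) (rpow_pos_of_pos ht0 _).le

open MeasureTheory ProbabilityTheory Set Real in
theorem integral_one_sub_exp_mul_rpow_pos {ω : ℝ} (hω₀ : 0 < ω) (hω₁ : ω < 1) :
    0 < ∫ t in Ioi (0 : ℝ), (2 - 2 * exp (-t ^ 2 / 2)) * t ^ (-1 - 2 * ω) := by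
  have hpos : ∀ t : ℝ, 0 < t → 0 < (2 - 2 * exp (-t ^ 2 / 2)) * t ^ (-1 - 2 * ω) := by
    intro t ht
    have : exp (-t ^ 2 / 2) < 1 := exp_lt_one_iff.2 (by nlinarith [sq_pos_of_pos ht])
    exact mul_pos (by linarith) (rpow_pos_of_pos ht _)
  rw [setIntegral_pos_iff_support_of_nonneg_ae
    ((ae_restrict_iff' measurableSet_Ioi).2 (.of_forall fun t ht ↦ (hpos t ht).le))
    (integrableOn_one_sub_exp_mul_rpow hω₀ hω₁)]
  have : Ioi (0 : ℝ) ⊆ Function.support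
      (fun t : ℝ ↦ (2 - 2 * exp (-t ^ 2 / 2)) * t ^ (-1 - 2 * ω)) := fun t ht ↦ (hpos t ht).ne'
  rw [inter_eq_right.2 this]
  simp

open MeasureTheory ProbabilityTheory Set Real in
/-- The substitution `t ↦ t * r` in the integral that represents a power of `r`. -/
theorem integral_one_sub_exp_scaled_mul_rpow {ω r : ℝ} (hω₀ : 0 < ω) (hω₁ : ω < 1) (hr : 0 ≤ r) :
    IntegrableOn (fun t : ℝ ↦ (2 - 2 * exp (-(t * r) ^ 2 / 2)) * t ^ (-1 - 2 * ω)) (Ioi 0) ∧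
    ∫ t in Ioi (0 : ℝ), (2 - 2 * exp (-(t * r) ^ 2 / 2)) * t ^ (-1 - 2 * ω)
      = r ^ (2 * ω) * ∫ t in Ioi (0 : ℝ), (2 - 2 * exp (-t ^ 2 / 2)) * t ^ (-1 - 2 * ω) := by
  rcases hr.eq_or_lt with rfl | hr
  · have : (0 : ℝ) ^ (2 * ω) = 0 := zero_rpow (by positivity)
    simp [this]
  set h : ℝ → ℝ := fun t ↦ (2 - 2 * exp (-t ^ 2 / 2)) * t ^ (-1 - 2 * ω) with hh
  have heq : EqOn (fun t : ℝ ↦ (2 - 2 * exp (-(t * r) ^ 2 / 2)) * t ^ (-1 - 2 * ω))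
      (fun t ↦ r ^ (1 + 2 * ω) * h (t * r)) (Ioi 0) := by
    intro t ht
    have ht0 : 0 < t := ht
    have : r ^ (1 + 2 * ω) * r ^ (-1 - 2 * ω) = 1 := by
      rw [← rpow_add hr, show 1 + 2 * ω + (-1 - 2 * ω) = 0 by ring, rpow_zero]
    simp only [hh]
    rw [mul_rpow ht0.le hr.le]
    linear_combination -(2 - 2 * exp (-(t * r) ^ 2 / 2)) * t ^ (-1 - 2 * ω) * this
  refine ⟨?_, ?_⟩
  · refine IntegrableOn.congr_fun (Integrable.const_mul ?_ _) heq.symm measurableSet_Ioi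
    have := (integrableOn_Ioi_comp_mul_right_iff h 0 hr).2
      (by simpa using integrableOn_one_sub_exp_mul_rpow hω₀ hω₁)
    exact this
  · rw [setIntegral_congr_fun measurableSet_Ioi heq, integral_const_mul,
      integral_comp_mul_right_Ioi h 0 hr, zero_mul, smul_eq_mul, ← mul_assoc,
      rpow_add hr, rpow_one]
    congr 1
    field_simp

open MeasureTheory ProbabilityTheory Set Real in
theorem integral_cos_inner_stdGaussian {E : Type*} [NormedAddCommGroup E] [InnerProductSpace ℝ E]
    [FiniteDimensional ℝ E] [MeasurableSpace E] [BorelSpace E] (z : E) :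
    ∫ g, cos (inner ℝ g z) ∂stdGaussian E = exp (-‖z‖ ^ 2 / 2) := by
  have hint : Integrable (fun g ↦ Complex.exp (inner ℝ g z * Complex.I)) (stdGaussian E) := by
    refine Integrable.of_bound (by fun_prop) 1 (.of_forall fun g ↦ ?_)
    rw [Complex.norm_exp_ofReal_mul_I]
  have h : ∫ g, Complex.exp (inner ℝ g z * Complex.I) ∂stdGaussian E
      = (exp (-‖z‖ ^ 2 / 2) : ℝ) := by
    rw [← charFun_apply, charFun_stdGaussian]
    push_cast
    rfl
  have h2 := integral_re hint
  rw [h] at h2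
  simpa [Complex.exp_ofReal_mul_I_re, -Complex.ofReal_exp] using h2

open MeasureTheory ProbabilityTheory Set Real in
/-- Integrating out the Gaussian variable turns the cosine into `exp (-(t * ‖z‖) ^ 2 / 2)`, and
integrating out the scale `t` then gives a multiple of `‖z‖ ^ (2 * ω)`. -/
theorem integral_gaussian_prod_cos_mul_rpow {ω : ℝ} (hω₀ : 0 < ω) (hω₁ : ω < 1)
    {E : Type*} [NormedAddCommGroup E] [InnerProductSpace ℝ E]
    [FiniteDimensional ℝ E] [MeasurableSpace E] [BorelSpace E] (z : E) :
    Integrable (fun p : E × ℝ ↦ (2 - 2 * cos (p.2 * inner ℝ p.1 z)) * p.2 ^ (-1 - 2 * ω))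
      ((stdGaussian E).prod (volume.restrict (Ioi 0))) ∧
    ∫ p, (2 - 2 * cos (p.2 * inner ℝ p.1 z)) * p.2 ^ (-1 - 2 * ω)
      ∂((stdGaussian E).prod (volume.restrict (Ioi 0)))
      = ‖z‖ ^ (2 * ω) * ∫ t in Ioi (0 : ℝ), (2 - 2 * exp (-t ^ 2 / 2)) * t ^ (-1 - 2 * ω) := by
  have hcos : ∀ t : ℝ, Integrable (fun g ↦ cos (t * inner ℝ g z)) (stdGaussian E) := fun t ↦
    Integrable.of_bound (by fun_prop) 1 (.of_forall fun g ↦ abs_cos_le_one _)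
  have hint : ∀ t : ℝ, Integrable
      (fun g ↦ (2 - 2 * cos (t * inner ℝ g z)) * t ^ (-1 - 2 * ω)) (stdGaussian E) := fun t ↦
    ((integrable_const 2).sub ((hcos t).const_mul 2)).mul_const _
  have hinner : ∀ t ∈ Ioi (0 : ℝ), ∫ g, (2 - 2 * cos (t * inner ℝ g z)) * t ^ (-1 - 2 * ω)
      ∂stdGaussian E = (2 - 2 * exp (-(t * ‖z‖) ^ 2 / 2)) * t ^ (-1 - 2 * ω) := by
    intro t ht
    have h := integral_cos_inner_stdGaussian (t • z)
    simp_rw [inner_smul_right, norm_smul, norm_of_nonneg (le_of_lt (show 0 < t from ht))] at h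
    rw [integral_mul_const, integral_sub (integrable_const 2) ((hcos t).const_mul 2),
      integral_const_mul, h]
    simp
  have hnorm : ∀ t ∈ Ioi (0 : ℝ), ∫ g, ‖(2 - 2 * cos (t * inner ℝ g z)) * t ^ (-1 - 2 * ω)‖
      ∂stdGaussian E = (2 - 2 * exp (-(t * ‖z‖) ^ 2 / 2)) * t ^ (-1 - 2 * ω) := by
    intro t ht
    rw [← hinner t ht]
    refine integral_congr_ae (.of_forall fun g ↦ norm_of_nonneg (mul_nonneg ?_ ?_))
    · linarith [cos_le_one (t * inner ℝ g z)]
    · exact (rpow_pos_of_pos ht _).le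
  obtain ⟨h1, h2⟩ := integral_one_sub_exp_scaled_mul_rpow hω₀ hω₁ (norm_nonneg z)
  have hI : Integrable
      (fun p : E × ℝ ↦ (2 - 2 * cos (p.2 * inner ℝ p.1 z)) * p.2 ^ (-1 - 2 * ω))
      ((stdGaussian E).prod (volume.restrict (Ioi 0))) := by
    refine (integrable_prod_iff' (by
      refine Measurable.aestronglyMeasurable ?_
      fun_prop)).2 ⟨.of_forall hint, ?_⟩
    exact IntegrableOn.congr_fun h1 (fun t ht ↦ (hnorm t ht).symm) measurableSet_Ioi
  refine ⟨hI, ?_⟩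
  rw [integral_prod_symm _ hI, ← h2]
  exact setIntegral_congr_fun measurableSet_Ioi hinner

open MeasureTheory ProbabilityTheory Set Real in
/-- Schoenberg's theorem: the `ω`-snowflake of a Euclidean space embeds isometrically into a Hilbert
space. For `ω < 1` the embedding sends `x` to a multiple of the function
`(g, t) ↦ (exp (i * t * ⟪g, x⟫) - 1) * t ^ (-1 / 2 - ω)` in `L²` of the Gaussian measure times
Lebesgue measure on the half-line. For `ω = 1` the integral in `t` diverges at `0`, but the space
itself serves as `H`. -/
theorem exists_snowflake_isometry_hilbert {ω : ℝ} (hω₀ : 0 < ω) (hω₁ : ω ≤ 1)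
    (E : Type) [NormedAddCommGroup E] [InnerProductSpace ℝ E] [FiniteDimensional ℝ E] :
    ∃ (H : Type) (_ : NormedAddCommGroup H) (_ : InnerProductSpace ℝ H) (_ : CompleteSpace H)
      (f : E → H), ∀ x y, ‖f x - f y‖ = ‖x - y‖ ^ ω := by
  rcases hω₁.eq_or_lt with rfl | hω₁
  · exact ⟨E, _, ‹_›, FiniteDimensional.complete ℝ E, id, fun x y ↦ by simp⟩
  let _ : MeasurableSpace E := borel E
  have : BorelSpace E := ⟨rfl⟩
  set μ : Measure (E × ℝ) := (stdGaussian E).prod (volume.restrict (Ioi 0)) with hμ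
  set J : ℝ := ∫ t in Ioi (0 : ℝ), (2 - 2 * exp (-t ^ 2 / 2)) * t ^ (-1 - 2 * ω)
  have hJ : 0 < J := integral_one_sub_exp_mul_rpow_pos hω₀ hω₁
  have hpos : ∀ᵐ p ∂μ, 0 < p.2 := by
    have : ∀ᵐ t ∂(volume.restrict (Ioi (0 : ℝ))), 0 < t :=
      (ae_restrict_iff' measurableSet_Ioi).2 (.of_forall fun t ht ↦ ht)
    exact Measure.quasiMeasurePreserving_snd.ae this
  let F : E → E × ℝ → ℂ := fun x p ↦
    (Complex.exp (((p.2 * inner ℝ p.1 x : ℝ) : ℂ) * Complex.I) - 1)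
      * ((p.2 ^ (-1 / 2 - ω) : ℝ) : ℂ)
  have hFm : ∀ x, AEStronglyMeasurable (F x) μ := fun x ↦ by
    refine Measurable.aestronglyMeasurable ?_
    fun_prop
  -- the squared length of a chord of the unit circle
  have hexp : ∀ a b : ℝ, ‖Complex.exp (a * Complex.I) - Complex.exp (b * Complex.I)‖ ^ 2
      = 2 - 2 * cos (a - b) := by
    intro a b
    rw [Complex.sq_norm, Complex.normSq_apply]
    simp only [Complex.sub_re, Complex.sub_im, Complex.exp_ofReal_mul_I_re,
      Complex.exp_ofReal_mul_I_im]
    rw [cos_sub]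
    linear_combination sin_sq_add_cos_sq a + sin_sq_add_cos_sq b
  have hpow : ∀ t : ℝ, 0 < t → ‖((t ^ (-1 / 2 - ω) : ℝ) : ℂ)‖ ^ 2 = t ^ (-1 - 2 * ω) := by
    intro t ht
    rw [Complex.norm_real, norm_of_nonneg (rpow_pos_of_pos ht _).le, ← rpow_natCast,
      ← rpow_mul ht.le]
    congr 1
    push_cast
    ring
  have hsub : ∀ x y, (fun p ↦ ‖F x p - F y p‖ ^ 2) =ᵐ[μ]
      fun p ↦ (2 - 2 * cos (p.2 * inner ℝ p.1 (x - y))) * p.2 ^ (-1 - 2 * ω) := by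
    intro x y
    filter_upwards [hpos] with p hp
    have : F x p - F y p = (Complex.exp (((p.2 * inner ℝ p.1 x : ℝ) : ℂ) * Complex.I)
        - Complex.exp (((p.2 * inner ℝ p.1 y : ℝ) : ℂ) * Complex.I))
        * ((p.2 ^ (-1 / 2 - ω) : ℝ) : ℂ) := by
      simp only [F]
      ring
    rw [this, norm_mul, mul_pow, hexp, hpow _ hp, inner_sub_right, mul_sub]
  -- the subtraction of `1` in `F` makes `F 0 = 0`, so that each `F x` is square integrable
  have hF0 : F 0 = 0 := by
    ext p
    simp [F]
  have hF : ∀ x, MemLp (F x) 2 μ := by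
    intro x
    rw [memLp_two_iff_integrable_sq_norm (hFm x)]
    have h := (integral_gaussian_prod_cos_mul_rpow hω₀ hω₁ (x - 0)).1.congr (hsub x 0).symm
    simpa [hF0] using h
  have hnorm : ∀ x y, ‖(hF x).toLp - (hF y).toLp‖ ^ 2 = ‖x - y‖ ^ (2 * ω) * J := by
    intro x y
    rw [← (integral_gaussian_prod_cos_mul_rpow hω₀ hω₁ (x - y)).2, ← MemLp.toLp_sub,
      ← real_inner_self_eq_norm_sq, L2.inner_def]
    refine integral_congr_ae ?_
    filter_upwards [((hF x).sub (hF y)).coeFn_toLp, hsub x y] with p h1 h2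
    rw [h1, real_inner_self_eq_norm_sq, ← h2]
    rfl
  refine ⟨Lp ℂ 2 μ, inferInstance, inferInstance, inferInstance,
    fun x ↦ (√J)⁻¹ • (hF x).toLp, fun x y ↦ ?_⟩
  rw [← smul_sub, norm_smul, norm_of_nonneg (by positivity)]
  refine (sq_eq_sq₀ (by positivity) (by positivity)).1 ?_
  rw [mul_pow, hnorm, inv_pow, sq_sqrt hJ.le, ← rpow_natCast (‖x - y‖ ^ ω),
    ← rpow_mul (norm_nonneg _), show ω * ((2 : ℕ) : ℝ) = 2 * ω by push_cast; ring]
  field_simp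

/-! ### Maximal ellipsoids -/

/-- If `‖p‖ ^ 2` exceeds the dimension, some map `A` of determinant of absolute value more than `1`
sends the unit ball into the convex hull of the unit ball and `±p`. The inclusion is expressed by
duality: a functional `⟪v, ·⟫` that is at most `1` on the ball and at `±p` is at most `1` on the
image of the ball. The map stretches by `a` in the direction of `p` and shrinks by `b` in the
orthogonal directions. -/
theorem exists_det_gt_one_of_finrank_lt_norm_sq {E : Type*} [NormedAddCommGroup E]
    [InnerProductSpace ℝ E] [FiniteDimensional ℝ E] {k : ℕ} (hk : 1 ≤ k)
    (hE : Module.finrank ℝ E = k) {p : E} (hp : (k : ℝ) < ‖p‖ ^ 2) :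
    ∃ A : E →L[ℝ] E, 1 < |A.det| ∧
      ∀ v, ‖v‖ ≤ 1 → |inner ℝ v p| ≤ 1 → ∀ x, inner ℝ v (A x) ≤ ‖x‖ := by
  obtain ⟨m, rfl⟩ : ∃ m, k = m + 1 := ⟨k - 1, by omega⟩
  push_cast at hp
  have hm : (0 : ℝ) ≤ m := m.cast_nonneg
  have hd : 0 < ‖p‖ := by
    by_contra h
    rw [le_antisymm (not_lt.1 h) (norm_nonneg p)] at hp
    norm_num at hp
    linarith
  set δ : ℝ := ‖p‖ ^ 2 - 1 with hδ
  have hδm : m < δ := by linarith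
  have hδ0 : 0 < δ := by linarith
  -- With `a ^ 2 = 1 + s * δ` and `b ^ 2 = 1 - s` the duality condition is tight, and the squared
  -- determinant is at least `(1 + s * δ) * (1 - m * s)`, which exceeds `1` for small `s > 0`
  -- because `m < δ`.
  set s : ℝ := (δ - m) / (2 * δ * (m + 1)) with hs
  have hs0 : 0 < s := div_pos (by linarith) (by positivity)
  have hs1 : s < 1 := by
    rw [hs, div_lt_one (by positivity)]
    nlinarith
  have hsm : s * δ * m < δ - m := by
    have : s * δ * m = (δ - m) * (m / (2 * (m + 1))) := by rw [hs]; field_simp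
    rw [this]
    refine mul_lt_of_lt_one_right (by linarith) ?_
    rw [div_lt_one (by positivity)]
    linarith
  set a : ℝ := √(1 + s * δ) with ha
  set b : ℝ := √(1 - s) with hb
  have ha2 : a ^ 2 = 1 + s * δ := Real.sq_sqrt (by positivity)
  have hb2 : b ^ 2 = 1 - s := Real.sq_sqrt (by linarith)
  have ha0 : 0 < a := Real.sqrt_pos.2 (by positivity)
  have hb0 : 0 < b := Real.sqrt_pos.2 (by linarith)
  set u : E := ‖p‖⁻¹ • p with hu
  have hu1 : inner ℝ u u = 1 := by
    rw [real_inner_self_eq_norm_sq, hu, norm_smul, norm_inv, norm_norm, inv_mul_cancel₀ hd.ne']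
    norm_num
  let B : E →ₗ[ℝ] E := b • LinearMap.transvection ((a / b - 1) • (innerₛₗ ℝ u)) u
  have hB : ∀ x, B x = b • x + ((a - b) * inner ℝ u x) • u := by
    intro x
    simp only [B, LinearMap.smul_apply, LinearMap.transvection.apply, innerₛₗ_apply_apply,
      smul_add, smul_smul, smul_eq_mul]
    congr 2
    field_simp
  refine ⟨LinearMap.toContinuousLinearMap B, ?_, fun v hv hvp x ↦ ?_⟩
  · have hdet : (LinearMap.toContinuousLinearMap B).det = a * b ^ m := by
      rw [ContinuousLinearMap.det, LinearMap.coe_toContinuousLinearMap, LinearMap.det_smul,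
        LinearMap.transvection.det, hE, LinearMap.smul_apply, innerₛₗ_apply_apply, hu1]
      simp only [smul_eq_mul]
      field_simp
      ring
    have hbern := one_add_mul_le_pow (show -2 ≤ -s by linarith) m
    have hsq : 1 < (a * b ^ m) ^ 2 := by
      calc 1 < (1 + s * δ) * (1 + m * -s) := by nlinarith
        _ ≤ (1 + s * δ) * (1 + -s) ^ m := by gcongr
        _ = (a * b ^ m) ^ 2 := by
          rw [mul_pow, ← pow_mul, mul_comm m, pow_mul, ha2, hb2, sub_eq_add_neg]
    rw [hdet, abs_of_pos (by positivity)]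
    exact (one_lt_sq_iff₀ (by positivity)).1 hsq
  · set c : ℝ := inner ℝ v u with hc
    have hpu : inner ℝ v p = ‖p‖ * c := by
      rw [hc, hu, inner_smul_right, mul_inv_cancel_left₀ hd.ne']
    have hcd : ‖p‖ ^ 2 * c ^ 2 ≤ 1 := by
      rw [← mul_pow, ← hpu]
      exact (sq_le_one_iff_abs_le_one _).2 hvp
    have hsymm : inner ℝ v (B x) = inner ℝ (B v) x := by
      simp only [hB, inner_add_left, inner_add_right, inner_smul_left, inner_smul_right,
        real_inner_comm, RCLike.conj_to_real]
      ring
    have hBv : ‖B v‖ ^ 2 ≤ 1 := by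
      have h1 : ‖B v‖ ^ 2 = b ^ 2 * ‖v‖ ^ 2 + (a ^ 2 - b ^ 2) * c ^ 2 := by
        rw [hB, ← real_inner_self_eq_norm_sq, ← real_inner_self_eq_norm_sq]
        simp only [inner_add_left, inner_add_right, inner_smul_left, inner_smul_right,
          RCLike.conj_to_real, hu1]
        rw [real_inner_comm v u, ← hc]
        ring
      have hv2 : ‖v‖ ^ 2 ≤ 1 := pow_le_one₀ (norm_nonneg v) hv
      rw [h1, ha2, hb2]
      nlinarith
    have hBv1 : ‖B v‖ ≤ 1 := (sq_le_one_iff₀ (norm_nonneg _)).1 hBv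
    calc inner ℝ v (B x) = inner ℝ (B v) x := hsymm
      _ ≤ ‖B v‖ * ‖x‖ := real_inner_le_norm _ _
      _ ≤ ‖x‖ := mul_le_of_le_one_left (norm_nonneg x) hBv1

/-- John's theorem: a `k`-dimensional normed space has Banach–Mazur distance at most `√k` to
Euclidean space. The map `A` is the inverse of a linear map `T` of maximal absolute determinant
among those that send the Euclidean unit ball into the unit ball of `X`. -/
theorem exists_euclidean_norm_equiv {X : Type*} [NormedAddCommGroup X] [NormedSpace ℝ X] {k : ℕ}
    (hk : 1 ≤ k) (hX : Module.finrank ℝ X = k) :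
    ∃ A : X →ₗ[ℝ] EuclideanSpace ℝ (Fin k), ∀ x, ‖x‖ ≤ ‖A x‖ ∧ ‖A x‖ ≤ √k * ‖x‖ := by
  have : FiniteDimensional ℝ X := FiniteDimensional.of_finrank_pos (by omega)
  set E := EuclideanSpace ℝ (Fin k)
  have hE : Module.finrank ℝ E = k := by simp [E]
  let e : X ≃L[ℝ] E := ContinuousLinearEquiv.ofFinrankEq (by rw [hX, hE])
  have : ProperSpace (E →L[ℝ] X) := FiniteDimensional.proper ℝ _
  obtain ⟨T, hT, hmax⟩ := (isCompact_closedBall (0 : E →L[ℝ] X) 1).exists_isMaxOn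
    ⟨0, by simp⟩ (f := fun T ↦ |((e : X →L[ℝ] E) ∘L T).det|) (by
      refine Continuous.continuousOn (continuous_abs.comp ?_)
      exact ContinuousLinearMap.continuous_det.comp (by fun_prop))
  have hT1 : ‖T‖ ≤ 1 := by simpa using hT
  have hdet : ((e : X →L[ℝ] E) ∘L T).det ≠ 0 := by
    -- a small multiple of `e.symm` is admissible and has nonzero determinant
    set c : ℝ := (‖(e.symm : E →L[ℝ] X)‖ + 1)⁻¹ with hc
    have hc0 : 0 < c := by positivity
    have hmem : c • (e.symm : E →L[ℝ] X) ∈ Metric.closedBall (0 : E →L[ℝ] X) 1 := by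
      rw [mem_closedBall_zero_iff, norm_smul, Real.norm_of_nonneg hc0.le, hc,
        inv_mul_le_one₀ (by positivity)]
      linarith
    have h := hmax hmem
    have h2 : (e : X →L[ℝ] E) ∘L (c • (e.symm : E →L[ℝ] X)) = c • ContinuousLinearMap.id ℝ E := by
      ext1 x
      simp
    have h3 : (c • ContinuousLinearMap.id ℝ E).det = c ^ k := by
      rw [ContinuousLinearMap.det, ContinuousLinearMap.toLinearMap_smul, LinearMap.det_smul, hE]
      simp
    simp only [Set.mem_ofPred_eq, h2, h3] at h
    intro h0
    rw [h0, abs_zero, abs_of_pos (by positivity)] at h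
    exact absurd h (not_le.2 (by positivity))
  -- a point `p` of the body `{‖T p‖ ≤ 1}` of length more than `√k` would allow a larger ellipsoid
  have hball : ∀ p : E, ‖T p‖ ≤ 1 → ‖p‖ ^ 2 ≤ k := by
    intro p hp
    by_contra! hlt
    obtain ⟨A, hA1, hA⟩ := exists_det_gt_one_of_finrank_lt_norm_sq hk hE hlt
    have hmem : T ∘L A ∈ Metric.closedBall (0 : E →L[ℝ] X) 1 := by
      rw [mem_closedBall_zero_iff]
      refine ContinuousLinearMap.opNorm_le_bound _ zero_le_one fun x ↦ ?_
      -- a norming functional of `T (A x)`, pulled back to the Euclidean space by `T`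
      obtain ⟨g, hg, hgx⟩ := exists_dual_vector'' ℝ (T (A x))
      set v : E := (InnerProductSpace.toDual ℝ E).symm (g ∘L T) with hv
      have hvx : ∀ y, inner ℝ v y = g (T y) := fun y ↦
        InnerProductSpace.toDual_symm_apply
      have hv1 : ‖v‖ ≤ 1 := by
        rw [hv, LinearIsometryEquiv.norm_map]
        exact (ContinuousLinearMap.opNorm_comp_le g T).trans
          (mul_le_one₀ hg (norm_nonneg _) hT1)
      have hvp : |inner ℝ v p| ≤ 1 := by
        rw [hvx, ← Real.norm_eq_abs]
        exact (g.le_opNorm _).trans (mul_le_one₀ hg (norm_nonneg _) hp)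
      have := hA v hv1 hvp x
      rw [hvx, hgx] at this
      simpa using this
    have h := hmax hmem
    have h2 : ((e : X →L[ℝ] E) ∘L (T ∘L A)).det = ((e : X →L[ℝ] E) ∘L T).det * A.det :=
      LinearMap.det_comp (((e : X →L[ℝ] E) ∘L T : E →L[ℝ] E) : E →ₗ[ℝ] E) (A : E →ₗ[ℝ] E)
    simp only [Set.mem_ofPred_eq, h2, abs_mul] at h
    exact absurd h (not_le.2 (lt_mul_of_one_lt_right (abs_pos.2 hdet) hA1))
  let B : E ≃L[ℝ] E := ContinuousLinearMap.toContinuousLinearEquivOfDetNeZero _ hdet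
  let A : X ≃L[ℝ] E := e.trans B.symm
  have hTA : ∀ x, T (A x) = x := by
    intro x
    apply e.injective
    exact B.apply_symm_apply (e x)
  refine ⟨A.toLinearEquiv.toLinearMap, fun x ↦ ⟨?_, ?_⟩⟩
  · change ‖x‖ ≤ ‖A x‖
    calc ‖x‖ = ‖T (A x)‖ := by rw [hTA]
      _ ≤ ‖T‖ * ‖A x‖ := T.le_opNorm _
      _ ≤ ‖A x‖ := mul_le_of_le_one_left (norm_nonneg _) hT1
  · change ‖A x‖ ≤ √k * ‖x‖
    rcases eq_or_ne x 0 with rfl | hx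
    · simp
    have hx0 : 0 < ‖x‖ := norm_pos_iff.2 hx
    have h := hball (‖x‖⁻¹ • A x) (by
      rw [map_smul, hTA, norm_smul, norm_inv, norm_norm, inv_mul_cancel₀ hx0.ne'])
    have h2 := Real.le_sqrt_of_sq_le h
    rw [norm_smul, norm_inv, norm_norm, inv_mul_le_iff₀ hx0] at h2
    linarith

/-! ### Distortion of snowflakes of normed spaces -/

/-- `Metric.Snowflaking M ω _ _` is `M` with the metric `dist x y ^ ω`, and `Fin k → ℝ` carries the
supremum norm, so it is `ℓ_∞^k`. -/
theorem lemma2 :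
    ∃ c : ℝ, 0 < c ∧
      ∀ (ω : ℝ) (hω₀ : 0 < ω) (hω₁ : ω ≤ 1) (k : ℕ), 1 ≤ k →
        (∀ (X : Type*) [NormedAddCommGroup X] [NormedSpace ℝ X], Module.finrank ℝ X = k →
          ∃ (H : Type) (_ : NormedAddCommGroup H) (_ : InnerProductSpace ℝ H)
            (_ : CompleteSpace H),
            EmbedsWithBiLipschitzDistortion (Metric.Snowflaking X ω hω₀ hω₁) H
              ((k : ℝ) ^ (ω / 2))) ∧
        (∀ (H : Type*) [NormedAddCommGroup H] [InnerProductSpace ℝ H] [CompleteSpace H] (D : ℝ),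
          EmbedsWithBiLipschitzDistortion (Metric.Snowflaking (Fin k → ℝ) ω hω₀ hω₁) H D →
            c * (k : ℝ) ^ (ω / 2) ≤ D) := by
  refine ⟨1 / 24, by norm_num, fun ω hω₀ hω₁ k hk ↦ ⟨?_, ?_⟩⟩
  · intro X _ _ hX
    obtain ⟨A, hA⟩ := exists_euclidean_norm_equiv hk hX
    obtain ⟨H, i₁, i₂, i₃, f, hf⟩ :=
      exists_snowflake_isometry_hilbert hω₀ hω₁ (EuclideanSpace ℝ (Fin k))
    have hdist : ∀ x y : Metric.Snowflaking X ω hω₀ hω₁,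
        dist x y = ‖x.ofSnowflaking - y.ofSnowflaking‖ ^ ω := fun x y ↦ by
      rw [← dist_eq_norm]
      rfl
    have hfA : ∀ x y : Metric.Snowflaking X ω hω₀ hω₁,
        dist (f (A x.ofSnowflaking)) (f (A y.ofSnowflaking))
          = ‖A (x.ofSnowflaking - y.ofSnowflaking)‖ ^ ω := fun x y ↦ by
      rw [dist_eq_norm, hf, map_sub]
    refine ⟨H, i₁, i₂, i₃, ?_, fun x ↦ f (A x.ofSnowflaking), fun x y ↦ ?_, fun x y ↦ ?_⟩
    · exact Real.one_le_rpow (by exact_mod_cast hk) (by positivity)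
    · rw [hfA, hdist]
      calc ‖A (x.ofSnowflaking - y.ofSnowflaking)‖ ^ ω
          ≤ (√k * ‖x.ofSnowflaking - y.ofSnowflaking‖) ^ ω :=
            Real.rpow_le_rpow (norm_nonneg _) (hA _).2 hω₀.le
        _ = (k : ℝ) ^ (ω / 2) * ‖x.ofSnowflaking - y.ofSnowflaking‖ ^ ω := by
            rw [Real.mul_rpow (Real.sqrt_nonneg _) (norm_nonneg _), Real.sqrt_eq_rpow,
              ← Real.rpow_mul k.cast_nonneg, one_div_mul_eq_div]
    · rw [hfA, hdist]
      exact Real.rpow_le_rpow (norm_nonneg _) (hA _).1 hω₀.le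
  · intro H _ _ _ D h
    exact rpow_le_distortion_of_embeds_snowflake hω₀ hω₁ hk h
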